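/- Throughout, $\log$ denotes the logarithm to base $2$ and $\exp(x)=e^x$. An $r$-prover question set is a finite nonempty set $\overline{Q}\subseteq Q^{(1)}\times\cdots\times Q^{(r)}$ such that every element of every alphabet $Q^{(j)}$ is the $j$-th entry of some tuple in $\overline{Q}$. An $r$-prover game $\mathcal{G}$ with question set $\overline{Q}$ consists of finite nonempty answer alphabets $A^{(1)},\dots,A^{(r)}$, with answer set $\overline{A}=A^{(1)}\times\cdots\times A^{(r)}$, and a verification predicate $V:\overline{Q}\times\overline{A}\to\{0,1\}$. A strategy is a tuple of functions $\mathcal{S}^{(j)}:Q^{(j)}\to A^{(j)}$, and $$\mathrm{val}(\mathcal{G})=\max_{\mathcal{S}^{(1)},\dots,\mathcal{S}^{(r)}}\Pr_{\overline{q}}\left[V\left(\overline{q},\mathcal{S}^{(1)}(q^{(1)}),\dots,\mathcal{S}^{(r)}(q^{(r)})\right)=1\right],$$ where $\overline{q}=(q^{(1)},\dots,q^{(r)})$ is uniform in $\overline{Q}$. The $n$-fold parallel repetition $\mathcal{G}^n$ is the $r$-prover game whose $j$-th prover has question alphabet $(Q^{(j)})^n$ and answer alphabet $(A^{(j)})^n$,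 whose question set is the $n$-fold product of $\overline{Q}$, and whose verifier accepts if and only if $V$ accepts in each of the $n$ coordinates. For $r\ge 2$ let $\overline{Q}_r\subseteq\{0,1\}^r$ be the set of all tuples with exactly one entry equal to $1$, regarded as an $r$-prover question set with question alphabets $\{0,1\}$. **Theorem.** Let $\ell\ge 2$ and $r=2^{\ell-1}+1$. There exists a constant $C_\ell>0$, depending only on $\ell$, such that for every $n\ge 2$ there exists an $r$-prover game $\mathcal{G}$ with question set $\overline{Q}_r$, with $\mathrm{val}(\mathcal{G})\le 1-1/r$ and with an answer set $\overline{A}$ of size $2^{rn}\le|\overline{A}|\le 2^{2rn}$, such that $$\mathrm{val}(\mathcal{G}^n)\ \ge\ \exp\left(-C_\ell\, n\cdot\frac{(\log\log|\overline{A}|)^{1/\ell}}{\log|\overline{A}|}\right).$$ -/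

import Mathlib

/-- An `r`-prover question set over the question alphabets `Q 0, …, Q (r - 1)`: a finite nonempty
set of question tuples such that every letter of every alphabet occurs in some tuple
("no impossible questions"). -/
structure QuestionSet {r : ℕ} (Q : Fin r → Type) where
  tuples : Set (∀ j, Q j)
  finite : tuples.Finite
  nonempty : tuples.Nonempty
  possible : ∀ (j : Fin r) (x : Q j), ∃ q ∈ tuples, q j = x

/-- The `n`-fold product of a question set: the `j`-th alphabet is `(Q j)^n`, and a tuple belongs
to the product iff each of its `n` coordinates belongs to the original question set. -/
def QuestionSet.pow {r : ℕ} {Q : Fin r → Type} (P : QuestionSet Q) (n : ℕ) :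
    QuestionSet (fun j => Fin n → Q j) where
  tuples := {q | ∀ i, (fun j => q j i) ∈ P.tuples}
  finite := by
    refine Set.Finite.of_injOn (f := fun q i j => q j i) (t := Set.univ.pi fun _ => P.tuples)
      (fun q hq i _ => hq i) (fun q _ q' _ h => ?_) (Set.Finite.pi fun _ => P.finite)
    funext j i
    exact congrFun (congrFun h i) j
  nonempty := by
    obtain ⟨q, hq⟩ := P.nonempty
    exact ⟨fun j _ => q j, fun _ => hq⟩
  possible := by
    intro j x
    choose q hq hx using fun i => P.possible j (x i)
    exact ⟨fun j i => q i j, hq, funext hx⟩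

/-- An `r`-prover game with a given question set: finite nonempty answer alphabets and a
verification predicate on question tuples (from the question set) and answer tuples. -/
structure MultiProverGame {r : ℕ} {Q : Fin r → Type} (P : QuestionSet Q) where
  A : Fin r → Type
  finite_answers : ∀ j, Finite (A j)
  nonempty_answers : ∀ j, Nonempty (A j)
  V : P.tuples → (∀ j, A j) → Bool

namespace MultiProverGame

variable {r : ℕ} {Q : Fin r → Type} {P : QuestionSet Q}

/-- A strategy: the `j`-th prover answers as a function of the `j`-th question only. -/
abbrev Strategy (G : MultiProverGame P) : Type := ∀ j, Q j → G.A j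

/-- The probability, over a uniformly random question tuple, that the verifier accepts. -/
noncomputable def winProb (G : MultiProverGame P) (S : G.Strategy) : ℝ :=
  (Nat.card {q : P.tuples // G.V q (fun j => S j (q.1 j)) = true} : ℝ) / (Nat.card P.tuples : ℝ)

/-- The value of the game: the maximal winning probability over all strategies
(the maximum is attained, see `isGreatest_value`). -/
noncomputable def value (G : MultiProverGame P) : ℝ := ⨆ S : G.Strategy, G.winProb S

/-- The size `|A^(1) × ⋯ × A^(r)|` of the answer set. -/
noncomputable def answerSize (G : MultiProverGame P) : ℕ := Nat.card (∀ j, G.A j)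

/-- The `n`-fold parallel repetition. -/
def repetition (G : MultiProverGame P) (n : ℕ) : MultiProverGame (P.pow n) where
  A := fun j => Fin n → G.A j
  finite_answers := fun j => by
    have := G.finite_answers j
    infer_instance
  nonempty_answers := fun j => by
    have := G.nonempty_answers j
    infer_instance
  V := fun q a => decide (∀ i : Fin n, G.V ⟨fun j => q.1 j i, q.2 i⟩ (fun j => a j i) = true)

theorem isGreatest_value (G : MultiProverGame P) : IsGreatest (Set.range G.winProb) G.value := by
  have hQ : ∀ j, Finite (Q j) := fun j => by
    have : (Set.univ : Set (Q j)).Finite :=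
      (P.finite.image fun q => q j).subset fun x _ => by
        obtain ⟨q, hq, hx⟩ := P.possible j x
        exact ⟨q, hq, hx⟩
    exact Set.finite_univ_iff.1 this
  have hA := G.finite_answers
  have hN := G.nonempty_answers
  have : Finite G.Strategy := inferInstance
  have : Nonempty G.Strategy := ⟨fun j _ => (hN j).some⟩
  refine ⟨?_, ?_⟩
  · exact exists_eq_ciSup_of_finite
  · rintro _ ⟨S, rfl⟩
    exact le_ciSup (Set.finite_range G.winProb).bddAbove S

end MultiProverGame

/-- The `r`-prover question set of all tuples in `{0,1}^r` with exactly one entry equal to `1`. -/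
def oneHotQuestions (r : ℕ) (hr : 2 ≤ r) : QuestionSet (fun _ : Fin r => Fin 2) where
  tuples := {q | {j | q j = 1}.ncard = 1}
  finite := Set.toFinite _
  nonempty := ⟨fun j => if j = ⟨0, by omega⟩ then 1 else 0, by simp⟩
  possible := by
    have key : ∀ k : Fin r,
        (fun j => if j = k then 1 else 0) ∈ {q : Fin r → Fin 2 | {j | q j = 1}.ncard = 1} := by
      intro k
      simp
    intro j x
    obtain rfl | rfl : x = 0 ∨ x = 1 := by
      fin_cases x <;> simp
    · have : Nontrivial (Fin r) := Fin.nontrivial_iff_two_le.2 hr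
      obtain ⟨k, hk⟩ := exists_ne j
      exact ⟨_, key k, if_neg hk.symm⟩
    · exact ⟨_, key j, if_pos rfl⟩

theorem two_le_of_eq_two_pow_add_one {k r : ℕ} (h : r = 2 ^ k + 1) : 2 ≤ r := by
  have := Nat.one_le_two_pow (n := k)
  omega

/-! A word `w` of length `n` over `r` letters encodes the questions of the repeated game: in round
`i` prover `w i` is asked 1. Prover `j` then sees exactly the level set of `j` in `w`. Take a set
`A` of words without combinatorial lines and let the base game ask for a common position and for the
level sets of a word in `A` that fits the question there (`wordGame`). In the repetition, honest
answers win whenever the word lies in `A`, so the value is at least the density of `A`. A perfect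
strategy for the base game would give one word for each question; since a prover asked 0 cannot tell
the questions apart, these words would form a line in `A`. So some question is lost.

Density comes from Rankin's iteration of Behrend's construction. Letter sums along a line form an
arithmetic progression, so it suffices to restrict the sum to a progression-free set. If integers
with small digits form a progression of degree `D`, so do their digits, and the squared norms form
one of degree `2 * D`; restricting the norms to a set avoiding degree `2 * D` makes all of these
constant. Each doubling improves the exponent of the loss, and `r > 2 ^ (ℓ - 1)` allows `ℓ - 1`
doublings. -/

open Polynomial in
/-- A set of integers avoids `k`-term progressions of degree `D` if every polynomial of degree at
most `D` whose values at `0, …, k - 1` lie in the set is constant on `0, …, k - 1`. -/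
def AvoidsPolyProgressions (k D : ℕ) (B : Finset ℤ) : Prop :=
  ∀ p : ℚ[X], p.natDegree ≤ D → (∀ i < k, ∃ b ∈ B, p.eval (i : ℚ) = b) →
    ∀ i < k, p.eval (i : ℚ) = p.eval 0

theorem AvoidsPolyProgressions.of_singleton (k D : ℕ) (c : ℤ) :
    AvoidsPolyProgressions k D {c} := by
  intro p _ h i hi
  obtain ⟨b, hb, h1⟩ := h i hi
  obtain ⟨b', hb', h2⟩ := h 0 (by omega)
  rw [Finset.mem_singleton] at hb hb'
  subst hb hb'
  rw [h1, ← h2, Nat.cast_zero]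

/-- Among the translates of `B ⊆ [0, N)`, some translate has a large preimage under a given
map with values in `[0, N)`. -/
theorem exists_translate_card_filter_ge {α : Type*} (X : Finset α) (f : α → ℕ) (N : ℕ)
    (hN : 0 < N) (hf : ∀ x ∈ X, f x < N) (B : Finset ℤ) (hB : ∀ b ∈ B, 0 ≤ b ∧ b < N) :
    ∃ t : ℤ, X.card * B.card ≤ 2 * N * (X.filter fun x => (f x : ℤ) + t ∈ B).card := by
  classical
  let g : α × ℤ → ℤ := fun y => y.2 - f y.1
  have hmaps : ∀ y ∈ X ×ˢ B, g y ∈ Finset.Ico (-N : ℤ) N := by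
    intro y hy
    rw [Finset.mem_product] at hy
    have h1 := hf _ hy.1
    have h2 := hB _ hy.2
    simp only [Finset.mem_Ico, g]
    omega
  have hne : (Finset.Ico (-N : ℤ) N).Nonempty := ⟨0, by simp [hN]⟩
  have hcard : (Finset.Ico (-N : ℤ) N).card = 2 * N := by
    rw [Int.card_Ico]; omega
  obtain ⟨t, -, ht⟩ := Finset.exists_max_image (Finset.Ico (-N : ℤ) N)
    (fun t => ((X ×ˢ B).filter fun y => g y = t).card) hne
  refine ⟨t, ?_⟩
  have hfib : ((X ×ˢ B).filter fun y => g y = t).card ≤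
      (X.filter fun x => (f x : ℤ) + t ∈ B).card := by
    refine Finset.card_le_card_of_injOn Prod.fst ?_ ?_
    · intro y hy
      simp only [Finset.coe_filter, Finset.mem_product, Set.mem_ofPred_eq, g] at hy ⊢
      refine ⟨hy.1.1, ?_⟩
      rw [← hy.2, add_sub_cancel]
      exact hy.1.2
    · intro y hy z hz hyz
      simp only [Finset.coe_filter, Finset.mem_product, Set.mem_ofPred_eq, g] at hy hz
      refine Prod.ext hyz ?_
      have := hy.2.trans hz.2.symm
      rw [hyz] at this
      linarith
  calc X.card * B.card = (X ×ˢ B).card := (Finset.card_product _ _).symm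
    _ = ∑ u ∈ Finset.Ico (-N : ℤ) N, ((X ×ˢ B).filter fun y => g y = u).card :=
      Finset.card_eq_sum_card_fiberwise hmaps
    _ ≤ ∑ _u ∈ Finset.Ico (-N : ℤ) N, ((X ×ˢ B).filter fun y => g y = t).card :=
      Finset.sum_le_sum ht
    _ = 2 * N * ((X ×ˢ B).filter fun y => g y = t).card := by
      rw [Finset.sum_const, hcard, smul_eq_mul]
    _ ≤ _ := Nat.mul_le_mul_left _ hfib

/-! ### Digits and polynomial progressions -/

/-- Uniqueness of expansions to base `b`: an expansion of zero with small digits is trivial. -/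
theorem eq_zero_of_sum_mul_pow_eq_zero (b : ℕ) :
    ∀ (d : ℕ) (c : Fin d → ℤ), (∀ l, |c l| < b) → ∑ l, c l * (b : ℤ) ^ (l : ℕ) = 0 →
      ∀ l, c l = 0 := by
  intro d
  induction d with
  | zero => exact fun _ _ _ l => l.elim0
  | succ d ih =>
    intro c hc h
    rw [Fin.sum_univ_succ] at h
    simp only [Fin.val_zero, pow_zero, mul_one, Fin.val_succ, pow_succ, ← mul_assoc] at h
    rw [← Finset.sum_mul] at h
    have h0 : c 0 = 0 := by
      refine Int.eq_zero_of_abs_lt_dvd (m := b) ?_ (hc 0)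
      exact ⟨-∑ l : Fin d, c l.succ * (b : ℤ) ^ (l : ℕ), by linarith⟩
    rw [h0, zero_add] at h
    have hb : (b : ℤ) ≠ 0 := by
      have := (abs_nonneg _).trans_lt (hc 0)
      exact this.ne'
    have := ih (fun l => c l.succ) (fun l => hc _) ((mul_eq_zero.1 h).resolve_right hb)
    exact fun l => Fin.cases h0 this l

open Polynomial in
/-- If a sum of squares of rational polynomials is constant, all of them are constant. -/
theorem natDegree_eq_zero_of_sum_sq_natDegree_eq_zero {ι : Type*} (s : Finset ι) (p : ι → ℚ[X])
    (h : (∑ l ∈ s, p l ^ 2).natDegree = 0) : ∀ l ∈ s, (p l).natDegree = 0 := by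
  intro l hl
  obtain ⟨m, hm, hmax⟩ := Finset.exists_max_image s (fun l => (p l).natDegree) ⟨l, hl⟩
  refine Nat.eq_zero_of_le_zero ((hmax l hl).trans ?_)
  by_contra hpos
  set e := (p m).natDegree with he
  -- With `e` the largest degree, the coefficient at `e + e` is a sum of squares of rationals, so
  -- nothing cancels.
  have hcoeff : (∑ l ∈ s, p l ^ 2).coeff (e + e) = 0 :=
    coeff_eq_zero_of_natDegree_lt (by omega)
  rw [finsetSum_coeff, Finset.sum_congr rfl fun l hl => by
    rw [sq, coeff_mul_add_eq_of_natDegree_le (hmax l hl) (hmax l hl), ← sq],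
    Finset.sum_eq_zero_iff_of_nonneg fun _ _ => sq_nonneg _] at hcoeff
  have h0 : (p m).leadingCoeff = 0 := pow_eq_zero_iff two_ne_zero |>.1 (hcoeff m hm)
  rw [leadingCoeff_eq_zero] at h0
  rw [h0, natDegree_zero] at he
  omega

open Polynomial in
/-- For a suitable constant `K`, if integers with digits less than `b / K` in base `b` form a
progression of degree `D`, then so do the digits. -/
theorem exists_digit_bound (k D : ℕ) : ∃ K : ℕ, 0 < K ∧
    ∀ (b d : ℕ) (x : ℕ → Fin d → ℕ), (∀ i < k, ∀ l, K * x i l < b) → D < k →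
      ∀ p : ℚ[X], p.natDegree ≤ D →
        (∀ i < k, p.eval (i : ℚ) = ∑ l, (x i l : ℚ) * (b : ℚ) ^ (l : ℕ)) →
        ∃ P : Fin d → ℚ[X], (∀ l, (P l).natDegree ≤ D) ∧
          ∀ l, ∀ i < k, (P l).eval (i : ℚ) = x i l := by
  have hinj : Set.InjOn (fun j : ℕ => (j : ℚ)) (Finset.range (D + 1) : Set ℕ) :=
    Nat.cast_injective.injOn
  let c : ℕ → ℕ → ℚ := fun i j =>
    (Lagrange.basis (Finset.range (D + 1)) (fun j : ℕ => (j : ℚ)) j).eval (i : ℚ)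
  have hinterp : ∀ (y : ℕ → ℚ) (i : ℕ),
      (Lagrange.interpolate (Finset.range (D + 1)) (fun j : ℕ => (j : ℚ)) y).eval (i : ℚ) =
        ∑ j ∈ Finset.range (D + 1), y j * c i j := by
    intro y i
    simp [Lagrange.interpolate_apply, eval_finsetSum, c]
  obtain ⟨T, hT⟩ := IsLocalization.exist_integer_multiples (nonZeroDivisors ℤ)
    (Finset.range k ×ˢ Finset.range (D + 1)) (fun y => c y.1 y.2)
  have hT0 : (T : ℤ) ≠ 0 := nonZeroDivisors.coe_ne_zero T
  have hT' : ∀ y : ℕ × ℕ, ∃ z : ℤ, y.1 < k → y.2 < D + 1 → (z : ℚ) = (T : ℤ) * c y.1 y.2 := by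
    intro y
    by_cases hy : y.1 < k ∧ y.2 < D + 1
    · obtain ⟨z, hz⟩ := hT y (by simpa using hy)
      refine ⟨z, fun _ _ => ?_⟩
      simpa [Submonoid.smul_def] using hz
    · exact ⟨0, fun h1 h2 => absurd ⟨h1, h2⟩ hy⟩
  choose z hz using hT'
  -- `T` clears the denominators of the Lagrange coefficients `c`, with numerators `z`; `K` bounds
  -- the total weight in the digit relations `e` below, so that they stay smaller than `b`.
  let K : ℕ := (T : ℤ).natAbs + ∑ i ∈ Finset.range k, ∑ j ∈ Finset.range (D + 1), (z (i, j)).natAbs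
  have hKpos : 0 < K := by
    have := Int.natAbs_pos.2 hT0
    omega
  refine ⟨K, hKpos, fun b d x hx hDk p hp hpx => ?_⟩
  let P : Fin d → ℚ[X] := fun l =>
    Lagrange.interpolate (Finset.range (D + 1)) (fun j : ℕ => (j : ℚ)) (fun j => (x j l : ℚ))
  refine ⟨P, fun l => ?_, fun l i hi => ?_⟩
  · have := Lagrange.degree_interpolate_le (fun j => (x j l : ℚ)) hinj
    rw [Finset.card_range, Nat.add_sub_cancel] at this
    exact natDegree_le_of_degree_le this
  · have hp_interp : p = Lagrange.interpolate (Finset.range (D + 1)) (fun j : ℕ => (j : ℚ))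
        (fun j => p.eval (j : ℚ)) := by
      refine Lagrange.eq_interpolate hinj ?_
      rw [Finset.card_range]
      exact degree_le_natDegree.trans_lt (by exact_mod_cast Nat.lt_succ_of_le hp)
    -- `T` times the error of interpolating digit `l` from the first `D + 1` terms. As `p` equals
    -- its own interpolation, the `e l` are the digits of an expansion of zero.
    let e : Fin d → ℤ := fun l =>
      (T : ℤ) * x i l - ∑ j ∈ Finset.range (D + 1), z (i, j) * x j l
    have heq : ∀ l, (e l : ℚ) =
        (T : ℤ) * ((x i l : ℚ) - ∑ j ∈ Finset.range (D + 1), (x j l : ℚ) * c i j) := by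
      intro l
      simp only [e]
      push_cast
      rw [mul_sub, Finset.mul_sum]
      congr 1
      refine Finset.sum_congr rfl fun j hj => ?_
      rw [hz (i, j) hi (Finset.mem_range.1 hj)]
      ring
    have hsum : ∑ l, e l * (b : ℤ) ^ (l : ℕ) = 0 := by
      have : ((∑ l, e l * (b : ℤ) ^ (l : ℕ) : ℤ) : ℚ) = 0 := by
        push_cast
        simp_rw [heq, mul_assoc, sub_mul, Finset.sum_mul]
        rw [← Finset.mul_sum, Finset.sum_sub_distrib, Finset.sum_comm, ← hpx i hi]
        have h1 : p.eval (i : ℚ) = ∑ j ∈ Finset.range (D + 1), p.eval (j : ℚ) * c i j := by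
          conv_lhs => rw [hp_interp]
          exact hinterp _ _
        rw [h1, mul_eq_zero, sub_eq_zero]
        refine Or.inr (Finset.sum_congr rfl fun j hj => ?_)
        rw [hpx j (by have := Finset.mem_range.1 hj; omega), Finset.sum_mul]
        exact Finset.sum_congr rfl fun l _ => by ring
      exact_mod_cast this
    have hbound : ∀ l, |e l| < b := by
      intro l
      obtain ⟨m, hm, hmax⟩ := Finset.exists_max_image (Finset.range k) (fun i => x i l)
        ⟨i, Finset.mem_range.2 hi⟩
      have hmb := hx m (Finset.mem_range.1 hm) l
      have h1 : |e l| ≤ (K : ℤ) * x m l := by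
        calc |e l| ≤ |(T : ℤ) * x i l| + |∑ j ∈ Finset.range (D + 1), z (i, j) * x j l| :=
              abs_sub _ _
          _ ≤ |(T : ℤ)| * x m l + ∑ j ∈ Finset.range (D + 1), |z (i, j)| * x m l := by
              gcongr
              · rw [abs_mul, Nat.abs_cast]
                gcongr
                exact_mod_cast hmax i (Finset.mem_range.2 hi)
              · refine (Finset.abs_sum_le_sum_abs _ _).trans (Finset.sum_le_sum fun j hj => ?_)
                rw [abs_mul, Nat.abs_cast]
                gcongr
                refine hmax j (Finset.mem_range.2 ?_)
                have := Finset.mem_range.1 hj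
                omega
          _ = (|(T : ℤ)| + ∑ j ∈ Finset.range (D + 1), |z (i, j)|) * x m l := by
              rw [add_mul, Finset.sum_mul]
          _ ≤ K * x m l := by
              gcongr
              simp only [K]
              push_cast
              gcongr
              exact Finset.single_le_sum
                (f := fun i => ∑ j ∈ Finset.range (D + 1), |z (i, j)|)
                (fun _ _ => Finset.sum_nonneg fun _ _ => abs_nonneg _) (Finset.mem_range.2 hi)
      exact h1.trans_lt (by exact_mod_cast hmb)
    have h0 := eq_zero_of_sum_mul_pow_eq_zero b d e hbound hsum l
    have h1 := heq l
    rw [h0, Int.cast_zero, eq_comm, mul_eq_zero] at h1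
    have h2 := h1.resolve_left (by exact_mod_cast hT0)
    rw [hinterp]
    linarith

open Polynomial in
/-- The digit construction: integers whose digit vectors (with small digits) have norm squares in
a translate of a set avoiding progressions of degree `2 * D` avoid progressions of degree `D`. -/
theorem AvoidsPolyProgressions.image_digits {k D K : ℕ} (hk : 2 * D + 1 ≤ k)
    (hK : ∀ (b d : ℕ) (x : ℕ → Fin d → ℕ), (∀ i < k, ∀ l, K * x i l < b) → D < k →
      ∀ p : ℚ[X], p.natDegree ≤ D →
        (∀ i < k, p.eval (i : ℚ) = ∑ l, (x i l : ℚ) * (b : ℚ) ^ (l : ℕ)) →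
        ∃ P : Fin d → ℚ[X], (∀ l, (P l).natDegree ≤ D) ∧
          ∀ l, ∀ i < k, (P l).eval (i : ℚ) = x i l)
    {B : Finset ℤ} (hB : AvoidsPolyProgressions k (2 * D) B) (t : ℤ) {b d : ℕ}
    (X : Finset (Fin d → ℕ)) (hX : ∀ x ∈ X, ∀ l, K * x l < b)
    (hXB : ∀ x ∈ X, ((∑ l, x l ^ 2 : ℕ) : ℤ) + t ∈ B) :
    AvoidsPolyProgressions k D
      (X.image fun x => ((∑ l : Fin d, x l * b ^ (l : ℕ) : ℕ) : ℤ)) := by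
  intro p hp hpX
  have hx : ∀ i, ∃ x : Fin d → ℕ, i < k →
      x ∈ X ∧ p.eval (i : ℚ) = ∑ l, (x l : ℚ) * (b : ℚ) ^ (l : ℕ) := by
    intro i
    by_cases hi : i < k
    · obtain ⟨y, hy, hpy⟩ := hpX i hi
      obtain ⟨x, hx, rfl⟩ := Finset.mem_image.1 hy
      refine ⟨x, fun _ => ⟨hx, ?_⟩⟩
      rw [hpy]
      push_cast
      rfl
    · exact ⟨0, fun h => absurd h hi⟩
  choose x hx using hx
  obtain ⟨P, hPdeg, hP⟩ := hK b d x (fun i hi => hX _ (hx i hi).1) (by omega) p hp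
    fun i hi => (hx i hi).2
  let q : ℚ[X] := ∑ l, P l ^ 2
  have hq : ∀ i < k, q.eval (i : ℚ) = (∑ l, x i l ^ 2 : ℕ) := by
    intro i hi
    simp only [q, eval_finsetSum, eval_pow]
    push_cast
    exact Finset.sum_congr rfl fun l _ => by rw [hP l i hi]
  have hqdeg : q.natDegree ≤ 2 * D := by
    refine natDegree_sum_le_of_forall_le _ _ fun l _ => ?_
    exact natDegree_pow_le.trans (Nat.mul_le_mul_left _ (hPdeg l))
  have hconst := hB (q + C (t : ℚ)) (by rwa [natDegree_add_C]) fun i hi =>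
    ⟨_, hXB _ (hx i hi).1, by rw [eval_add, eval_C, hq i hi]; push_cast; rfl⟩
  -- Constancy at `k > 2 * D` points forces a polynomial of degree at most `2 * D` to be constant.
  have hqC : q = C (q.eval 0) := by
    refine eq_of_natDegree_lt_card_of_eval_eq' _ _ ((Finset.range k).image fun i : ℕ => (i : ℚ))
      ?_ ?_
    · intro y hy
      obtain ⟨i, hi, rfl⟩ := Finset.mem_image.1 hy
      have := hconst i (Finset.mem_range.1 hi)
      rw [eval_add, eval_add, eval_C, eval_C] at this
      rw [eval_C]
      exact add_right_cancel this
    · rw [natDegree_C, Finset.card_image_of_injective _ Nat.cast_injective, Finset.card_range]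
      omega
  have hP0 := natDegree_eq_zero_of_sum_sq_natDegree_eq_zero Finset.univ P
    (show q.natDegree = 0 by rw [hqC, natDegree_C])
  intro i hi
  have h0 : 0 < k := by omega
  have hp0 := (hx 0 h0).2
  rw [Nat.cast_zero] at hp0
  rw [hp0, (hx i hi).2]
  refine Finset.sum_congr rfl fun l _ => ?_
  rw [← hP l i hi, ← hP l 0 h0, eq_C_of_natDegree_eq_zero (hP0 l (Finset.mem_univ l)), eval_C,
    eval_C]

/-- The base-`b` expansion of digits less than `b` is less than `b ^ d`. -/
theorem sum_mul_pow_lt_pow {b d : ℕ} (x : Fin d → ℕ) (hx : ∀ l, x l < b) :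
    ∑ l, x l * b ^ (l : ℕ) < b ^ d := by
  induction d with
  | zero => simp
  | succ d ih =>
    rw [Fin.sum_univ_castSucc, pow_succ]
    have h1 := ih (fun l => x l.castSucc) fun l => hx _
    have h2 : x (Fin.last d) + 1 ≤ b := hx _
    simp only [Fin.val_castSucc, Fin.val_last] at h1 ⊢
    calc _ < b ^ d + x (Fin.last d) * b ^ d := by gcongr
      _ = b ^ d * (x (Fin.last d) + 1) := by ring
      _ ≤ b ^ d * b := by gcongr

/-! ### Rankin's construction -/

/-- The approximate integer root. -/
theorem exists_pow_le_le_two_mul_pow {N s : ℕ} (hN : 1 ≤ N) (hs : 1 ≤ s) :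
    ∃ b : ℕ, 1 ≤ b ∧ b ^ s ≤ N ∧ N ≤ (2 * b) ^ s := by
  refine ⟨Nat.nthRoot s N, ?_, Nat.pow_nthRoot_le (by omega), ?_⟩
  · exact (Nat.le_nthRoot_iff (by omega)).2 (by simpa using hN)
  · have h1 : 1 ≤ Nat.nthRoot s N := (Nat.le_nthRoot_iff (by omega)).2 (by simpa using hN)
    exact (Nat.lt_pow_nthRoot_add_one (by omega) N).le.trans (Nat.pow_le_pow_left (by omega) s)

/-- Rankin's construction: dense sets avoiding progressions of degree `D` and length
`k > 2 ^ j * D`. -/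
theorem exists_dense_avoidsPolyProgressions (k : ℕ) : ∀ j D : ℕ, 2 ^ j * D + 1 ≤ k →
    ∃ C : ℕ, ∀ s N : ℕ, 1 ≤ s → 1 ≤ N → N ≤ 2 ^ s ^ (j + 1) →
      ∃ B : Finset ℤ, (∀ x ∈ B, 0 ≤ x ∧ x < N) ∧ AvoidsPolyProgressions k D B ∧
        N ≤ 2 ^ (C * s) * B.card := by
  intro j
  induction j with
  | zero =>
    intro D _
    -- Here `N ≤ 2 ^ s`, so a single point is dense enough.
    refine ⟨1, fun s N _ hN hNs => ⟨{0}, ?_, .of_singleton _ _ _, ?_⟩⟩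
    · simpa using Nat.pos_of_ne_zero (by omega)
    · simpa using hNs
  | succ j ih =>
    intro D hD
    have hDk : 2 ^ j * (2 * D) + 1 ≤ k := by rwa [← mul_assoc, ← pow_succ]
    have h2Dk : 2 * D + 1 ≤ k :=
      (Nat.succ_le_succ (Nat.le_mul_of_pos_left _ (by positivity))).trans hDk
    obtain ⟨C, hC⟩ := ih (2 * D) hDk
    obtain ⟨K, hKpos, hK⟩ := exists_digit_bound k D
    refine ⟨K + 3 * C + 2, fun s N hs hN hNs => ?_⟩
    obtain ⟨b, hb, hbN, hNb⟩ := exists_pow_le_le_two_mul_pow hN hs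
    -- The number of digits `y` with `K * y < b`.
    set m := (b - 1) / K + 1 with hm
    have hdigit : ∀ y < m, K * y < b := by
      intro y hy
      have h1 : K * y ≤ K * ((b - 1) / K) := Nat.mul_le_mul_left _ (by omega)
      have h2 := Nat.mul_div_le (b - 1) K
      omega
    have hbm : b ≤ K * m := by
      have := Nat.lt_mul_div_succ (b - 1) hKpos
      rw [← hm] at this
      omega
    have hmb : m ≤ b := by
      have := Nat.div_le_self (b - 1) K
      omega
    have hbs : b ≤ 2 ^ s ^ (j + 1) := by
      refine le_of_pow_le_pow_left₀ (by omega : s ≠ 0) (by positivity) (hbN.trans (hNs.trans ?_))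
      rw [← pow_mul, ← pow_succ]
    -- Squared norms are below `s * m ^ 2`; this range has exponent at most `3 * s ^ (j + 1)`, so
    -- the induction hypothesis applies with `3 * s`.
    have hN' : s * m ^ 2 ≤ 2 ^ (3 * s) ^ (j + 1) := by
      calc s * m ^ 2 ≤ 2 ^ s ^ (j + 1) * (2 ^ s ^ (j + 1)) ^ 2 := by
            gcongr
            · exact Nat.lt_two_pow_self.le.trans
                (Nat.pow_le_pow_right (by norm_num) (Nat.le_self_pow (by omega) s))
            · exact hmb.trans hbs
        _ = 2 ^ (3 * s ^ (j + 1)) := by rw [← pow_mul, ← pow_add]; ring_nf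
        _ ≤ 2 ^ (3 * s) ^ (j + 1) := by
            rw [mul_pow]
            gcongr
            · norm_num
            · exact Nat.le_self_pow (by omega) 3
    have hN'pos : 1 ≤ s * m ^ 2 := Nat.mul_pos hs (by positivity)
    obtain ⟨B, hBr, hB, hBcard⟩ := hC (3 * s) (s * m ^ 2) (by omega) hN'pos hN'
    let X : Finset (Fin s → ℕ) := Fintype.piFinset fun _ => Finset.range m
    have hXm : ∀ x ∈ X, ∀ l, x l < m := fun x hx l =>
      Finset.mem_range.1 (Fintype.mem_piFinset.1 hx l)
    have hXcard : X.card = m ^ s := by simp [X]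
    obtain ⟨t, ht⟩ := exists_translate_card_filter_ge X (fun x => ∑ l, x l ^ 2) (s * m ^ 2)
      hN'pos (fun x hx => by
        calc ∑ l, x l ^ 2 < ∑ _l : Fin s, m ^ 2 := by
              refine Finset.sum_lt_sum_of_nonempty ⟨⟨0, hs⟩, Finset.mem_univ _⟩ fun l _ => ?_
              exact Nat.pow_lt_pow_left (hXm x hx l) two_ne_zero
          _ = s * m ^ 2 := by simp) B (by exact_mod_cast hBr)
    set Y := X.filter fun x => ((∑ l, x l ^ 2 : ℕ) : ℤ) + t ∈ B with hY
    have hYX : ∀ x ∈ Y, x ∈ X := fun x hx => (Finset.mem_filter.1 hx).1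
    have hlt : ∀ x ∈ Y, ∀ l, x l < b := fun x hx l => (hXm x (hYX x hx) l).trans_le hmb
    refine ⟨Y.image fun x => ((∑ l : Fin s, x l * b ^ (l : ℕ) : ℕ) : ℤ), ?_, ?_, ?_⟩
    · intro y hy
      obtain ⟨x, hx, rfl⟩ := Finset.mem_image.1 hy
      exact ⟨Int.natCast_nonneg _,
        Int.ofNat_lt.2 ((sum_mul_pow_lt_pow x (hlt x hx)).trans_le hbN)⟩
    · exact hB.image_digits h2Dk hK t Y (fun x hx l => hdigit _ (hXm x (hYX x hx) l))
        fun x hx => (Finset.mem_filter.1 hx).2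
    · have hinj : Set.InjOn (fun x : Fin s → ℕ => ((∑ l : Fin s, x l * b ^ (l : ℕ) : ℕ) : ℤ)) Y := by
        intro x hx y hy hxy
        have h0 := eq_zero_of_sum_mul_pow_eq_zero b s (fun l => (x l : ℤ) - y l)
          (fun l => by
            have h1 := hlt x hx l
            have h2 := hlt y hy l
            rw [abs_lt]
            omega)
          (by
            simp only [sub_mul, Finset.sum_sub_distrib]
            rw [sub_eq_zero]
            have hxy' := Nat.cast_injective hxy
            exact_mod_cast hxy')
        funext l
        have := h0 l
        omega
      rw [Finset.card_image_of_injOn hinj]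
      rw [hXcard] at ht
      have hBpos : 0 < B.card := by
        by_contra h
        have : B.card = 0 := by omega
        rw [this, mul_zero] at hBcard
        omega
      have h1 : m ^ s ≤ 2 * 2 ^ (C * (3 * s)) * Y.card := by
        refine Nat.le_of_mul_le_mul_right (ht.trans ?_) hBpos
        calc 2 * (s * m ^ 2) * Y.card
            ≤ 2 * (2 ^ (C * (3 * s)) * B.card) * Y.card := by gcongr
          _ = _ := by ring
      -- The loss is `(K + 1) * s` from rounding the root and shrinking the digits, `s` from the
      -- translate and `3 * C * s` from `B`.
      calc N ≤ (2 * (K * m)) ^ s := hNb.trans (by gcongr)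
        _ = (2 * K) ^ s * m ^ s := by rw [← mul_pow]; ring_nf
        _ ≤ (2 * 2 ^ K) ^ s * (2 ^ s * 2 ^ (C * (3 * s)) * Y.card) := by
            gcongr
            · exact Nat.lt_two_pow_self.le
            · refine h1.trans ?_
              gcongr
              exact Nat.le_self_pow (by omega) 2
        _ = 2 ^ ((K + 3 * C + 2) * s) * Y.card := by
            rw [← pow_succ', ← pow_mul]
            ring_nf

/-! ### Line-free sets of words -/

/-- For `r > 2 ^ j`, there are dense sets of words over an alphabet of size `r` containing no
combinatorial line. -/
theorem exists_dense_lineFree {r j : ℕ} (hr : 2 ^ j + 1 ≤ r) :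
    ∃ C : ℕ, ∀ s n : ℕ, 1 ≤ s → 1 ≤ n → r * n ≤ 2 ^ s ^ (j + 1) →
      ∃ A : Finset (Fin n → Fin r), (∀ L : Combinatorics.Line (Fin r) (Fin n), ∃ x, L x ∉ A) ∧
        r ^ n ≤ 2 ^ (C * s) * A.card := by
  obtain ⟨C, hC⟩ := exists_dense_avoidsPolyProgressions r j 1 (by simpa using hr)
  refine ⟨C + 1, fun s n hs hn hns => ?_⟩
  have hr2 : 2 ≤ r := (Nat.succ_le_succ Nat.one_le_two_pow).trans hr
  have hN : 1 ≤ r * n := Nat.mul_pos (by omega) hn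
  obtain ⟨B, hBr, hB, hBcard⟩ := hC s (r * n) hs hN hns
  obtain ⟨t, ht⟩ := exists_translate_card_filter_ge (Finset.univ : Finset (Fin n → Fin r))
    (fun w => ∑ i, (w i : ℕ)) (r * n) hN (fun w _ => by
      calc ∑ i, (w i : ℕ) < ∑ _i : Fin n, r :=
            Finset.sum_lt_sum_of_nonempty ⟨⟨0, hn⟩, Finset.mem_univ _⟩ fun i _ => (w i).2
        _ = r * n := by simp [mul_comm]) B (by exact_mod_cast hBr)
  refine ⟨Finset.univ.filter fun w : Fin n → Fin r => ((∑ i, (w i : ℕ) : ℕ) : ℤ) + t ∈ B,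
    fun L => ?_, ?_⟩
  rotate_left
  · rw [Finset.card_univ, Fintype.card_fun, Fintype.card_fin, Fintype.card_fin] at ht
    set A := Finset.univ.filter fun w : Fin n → Fin r => ((∑ i, (w i : ℕ) : ℕ) : ℤ) + t ∈ B
    have hBpos : 0 < B.card := by
      by_contra h
      have : B.card = 0 := by omega
      rw [this, mul_zero] at hBcard
      omega
    refine Nat.le_of_mul_le_mul_right (ht.trans ?_) hBpos
    calc 2 * (r * n) * A.card ≤ 2 ^ s * (2 ^ (C * s) * B.card) * A.card := by
          gcongr
          exact Nat.le_self_pow (by omega) 2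
      _ = 2 ^ ((C + 1) * s) * A.card * B.card := by ring
  · by_contra! hL
    classical
    let R := Finset.univ.filter fun i => L.idxFun i = none
    let a : ℕ := ∑ i, (L.idxFun i).elim 0 fun y : Fin r => (y : ℕ)
    -- Along a line the letter sum is affine, with slope the number of active coordinates, which is
    -- positive.
    have hsum : ∀ x : Fin r, ∑ i, ((L x i : Fin r) : ℕ) = a + R.card * x := by
      intro x
      rw [Finset.card_filter, Finset.sum_mul, ← Finset.sum_add_distrib]
      refine Finset.sum_congr rfl fun i _ => ?_
      rw [Combinatorics.Line.apply_def]
      rcases h : L.idxFun i with _ | y <;> simp [h]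
    have hR : 0 < R.card := by
      obtain ⟨i, hi⟩ := L.proper
      exact Finset.card_pos.2 ⟨i, by simpa [R] using hi⟩
    let p : Polynomial ℚ :=
      Polynomial.C (R.card : ℚ) * Polynomial.X + Polynomial.C ((a : ℚ) + t)
    have hp : ∀ x : ℚ, p.eval x = R.card * x + (a + t) := fun x => by simp [p]
    have := hB p Polynomial.natDegree_linear_le (fun i hi => by
      refine ⟨_, (Finset.mem_filter.1 (hL ⟨i, hi⟩)).2, ?_⟩
      rw [hp, hsum]
      push_cast
      ring) 1 (by omega)
    rw [hp, hp] at this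
    have h0 : (R.card : ℚ) = 0 := by
      push_cast at this
      linarith
    exact hR.ne' (by exact_mod_cast h0)

/-- Words `w k` that look alike outside the letters `k` and `k'`, for all `k` and `k'`, and read
`k` at a common position, form a combinatorial line. -/
theorem exists_line_of_forall_apply_eq_iff {r : ℕ} {ι : Type*} (hr : 3 ≤ r)
    (w : Fin r → ι → Fin r)
    (h : ∀ k k' j, j ≠ k → j ≠ k' → ∀ m, w k m = j ↔ w k' m = j)
    (i : ι) (hi : ∀ k, w k i = k) :
    ∃ L : Combinatorics.Line (Fin r) ι, ∀ k, L k = w k := by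
  classical
  have third : ∀ a c : Fin r, ∃ x, x ≠ a ∧ x ≠ c := by
    intro a c
    obtain ⟨x, hx⟩ := Finset.exists_mem_notMem_of_card_lt_card (s := {a, c})
      (t := (Finset.univ : Finset (Fin r)))
      (Finset.card_le_two.trans_lt (by rw [Finset.card_fin]; omega))
    exact ⟨x, by simpa using hx⟩
  have hr0 : 0 < r := by omega
  -- Off the active positions all the words turn out to agree, so the choice of word 0 is
  -- immaterial.
  refine ⟨⟨fun m => if ∀ k, w k m = k then none else some (w ⟨0, hr0⟩ m), i, if_pos hi⟩,
    fun k => funext fun m => ?_⟩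
  rw [Combinatorics.Line.apply_def]
  by_cases hm : ∀ k, w k m = k
  · simp [hm]
  · simp only [if_neg hm, Option.getD_some]
    push Not at hm
    obtain ⟨k₀, hk₀⟩ := hm
    have key : ∀ k, w k m = w k₀ m := by
      -- The letter `w k₀ m` differs from `k₀`, so it passes to every word `w k` except the one
      -- indexed by that letter; a third index handles that word.
      have h1 : ∀ k, k ≠ w k₀ m → w k m = w k₀ m := fun k hk =>
        (h k k₀ (w k₀ m) hk.symm hk₀ m).2 rfl
      intro k
      by_cases hk : k = w k₀ m
      · by_contra hne
        obtain ⟨x, hx1, hx2⟩ := third (w k m) (w k₀ m)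
        have h2 := (h x k (w k m) hx1.symm (fun h => hne (h.trans hk)) m).2 rfl
        exact hne (h2.symm.trans (h1 x hx2))
      · exact h1 k hk
    rw [key, key k]

/-! ### Questions as words, and the game -/

/-- The question tuple whose `k`-th entry is `1`. -/
def oneHot {r : ℕ} (k : Fin r) : Fin r → Fin 2 := fun j => if j = k then 1 else 0

theorem oneHot_eq_one_iff {r : ℕ} (k j : Fin r) : oneHot k j = 1 ↔ j = k := by
  simp [oneHot]

theorem oneHot_mem {r : ℕ} (hr : 2 ≤ r) (k : Fin r) : oneHot k ∈ (oneHotQuestions r hr).tuples := by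
  simp [oneHotQuestions, oneHot]

theorem exists_oneHot_eq {r : ℕ} (hr : 2 ≤ r) {q : Fin r → Fin 2}
    (hq : q ∈ (oneHotQuestions r hr).tuples) : ∃ k, oneHot k = q := by
  obtain ⟨k, hk⟩ := Set.ncard_eq_one.1 hq
  refine ⟨k, funext fun j => ?_⟩
  have h : q j = 1 ↔ j = k := by
    have := Set.ext_iff.1 hk j
    simpa using this
  have h' := oneHot_eq_one_iff k j
  generalize oneHot k j = x at *
  generalize q j = y at *
  by_cases hj : j = k
  · rw [h.2 hj, h'.2 hj]
  · have := mt h.1 hj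
    have := mt h'.1 hj
    omega

theorem oneHot_injective {r : ℕ} : Function.Injective (oneHot (r := r)) := by
  intro k k' h
  have := (oneHot_eq_one_iff k k).2 rfl
  rw [h] at this
  exact (oneHot_eq_one_iff k' k).1 this

/-- Question tuples of the repeated game correspond to words. -/
noncomputable def wordEquiv {r : ℕ} (hr : 2 ≤ r) (n : ℕ) :
    (Fin n → Fin r) ≃ ((oneHotQuestions r hr).pow n).tuples :=
  Equiv.ofBijective
    (fun w => ⟨fun j i => oneHot (w i) j, fun i => oneHot_mem hr (w i)⟩) <| by
    constructor
    · intro w w' h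
      funext i
      refine oneHot_injective (funext fun j => ?_)
      exact congrFun (congrFun (congrArg Subtype.val h) j) i
    · rintro ⟨q, hq⟩
      choose w hw using fun i => exists_oneHot_eq hr (hq i)
      refine ⟨w, Subtype.ext (funext fun j => funext fun i => ?_)⟩
      exact congrFun (hw i) j

theorem wordEquiv_apply {r : ℕ} (hr : 2 ≤ r) (n : ℕ) (w : Fin n → Fin r) (j : Fin r) (i : Fin n) :
    (wordEquiv hr n w).1 j i = oneHot (w i) j := rfl

theorem card_oneHotQuestions {r : ℕ} (hr : 2 ≤ r) :
    Nat.card (oneHotQuestions r hr).tuples = r := by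
  have h : Function.Bijective
      (fun k : Fin r => (⟨oneHot k, oneHot_mem hr k⟩ : (oneHotQuestions r hr).tuples)) := by
    refine ⟨fun k k' h => oneHot_injective (congrArg Subtype.val h), ?_⟩
    rintro ⟨q, hq⟩
    obtain ⟨k, rfl⟩ := exists_oneHot_eq hr hq
    exact ⟨k, rfl⟩
  rw [← Nat.card_congr (Equiv.ofBijective _ h), Nat.card_fin]

open Classical in
/-- The game associated with a set `A` of words of length `n`: every prover names a position and a
set of positions; the verifier accepts if all provers name the same position `i` and the sets are
the level sets of a word in `A` whose `i`-th letter is the prover asked `1`. -/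
noncomputable def wordGame {r n : ℕ} (hr : 2 ≤ r) (hn : 1 ≤ n) (A : Finset (Fin n → Fin r)) :
    MultiProverGame (oneHotQuestions r hr) where
  A := fun _ => Fin n × Finset (Fin n)
  finite_answers := fun _ => inferInstance
  nonempty_answers := fun _ => ⟨(⟨0, hn⟩, ∅)⟩
  V := fun q a => decide (∃ i, ∃ w ∈ A, q.1 = oneHot (w i) ∧
    ∀ j, a j = (i, Finset.univ.filter fun m => w m = j))

theorem answerSize_wordGame {r n : ℕ} (hr : 2 ≤ r) (hn : 1 ≤ n) (A : Finset (Fin n → Fin r)) :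
    (wordGame hr hn A).answerSize = (n * 2 ^ n) ^ r := by
  simp [MultiProverGame.answerSize, wordGame, Nat.card_eq_fintype_card]

/-- A strategy winning all `r` questions would yield a line in `A`. For any two questions some third
prover is asked 0 in both, which forces a common position; this needs `r ≥ 3`. -/
theorem value_wordGame_le {r n : ℕ} (hr : 3 ≤ r) (hn : 1 ≤ n) (A : Finset (Fin n → Fin r))
    (hA : ∀ L : Combinatorics.Line (Fin r) (Fin n), ∃ x, L x ∉ A) :
    (wordGame (by omega : 2 ≤ r) hn A).value ≤ 1 - 1 / (r : ℝ) := by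
  have hr2 : 2 ≤ r := by omega
  obtain ⟨S, hS⟩ := (wordGame hr2 hn A).isGreatest_value.1
  rw [← hS, MultiProverGame.winProb, card_oneHotQuestions]
  have hrpos : (0 : ℝ) < r := by exact_mod_cast (by omega : 0 < r)
  have hfin := (oneHotQuestions r hr2).finite.to_subtype
  suffices h : Nat.card {q : (oneHotQuestions r hr2).tuples //
      (wordGame hr2 hn A).V q (fun j => S j (q.1 j)) = true} + 1 ≤ r by
    rw [div_le_iff₀ hrpos, sub_mul, one_div, inv_mul_cancel₀ hrpos.ne', one_mul, le_sub_iff_add_le]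
    exact_mod_cast h
  have hlose : ∃ q : (oneHotQuestions r hr2).tuples,
      ¬ (wordGame hr2 hn A).V q (fun j => S j (q.1 j)) = true := by
    by_contra! hwin
    simp only [wordGame, decide_eq_true_eq] at hwin
    choose i w hwA hq hans using fun k => hwin ⟨oneHot k, oneHot_mem hr2 k⟩
    have hwi : ∀ k, w k (i k) = k := fun k => (oneHot_injective (hq k)).symm
    have hans' : ∀ k j, j ≠ k → S j 0 = (i k, Finset.univ.filter fun m => w k m = j) := by
      intro k j hj
      have := hans k j
      simp only [show oneHot k j = 0 from if_neg hj] at this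
      exact this
    have hi : ∀ k k', i k = i k' := by
      intro k k'
      obtain ⟨j, hj⟩ := Finset.exists_mem_notMem_of_card_lt_card (s := {k, k'})
        (t := (Finset.univ : Finset (Fin r))) (Finset.card_le_two.trans_lt (by rw [Finset.card_fin]; omega))
      have hj : j ≠ k ∧ j ≠ k' := by simpa using hj
      exact congrArg Prod.fst ((hans' k j hj.1).symm.trans (hans' k' j hj.2))
    obtain ⟨L, hL⟩ := exists_line_of_forall_apply_eq_iff hr w
      (fun k k' j hj hj' m => by
        have := congrArg Prod.snd ((hans' k j hj).symm.trans (hans' k' j hj'))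
        simpa using Finset.ext_iff.1 this m)
      (i ⟨0, by omega⟩) (fun k => by rw [hi _ k]; exact hwi k)
    obtain ⟨x, hx⟩ := hA L
    exact hx (hL x ▸ hwA x)
  obtain ⟨q, hq⟩ := hlose
  have := Finite.card_subtype_lt (p := fun q : (oneHotQuestions r hr2).tuples =>
    (wordGame hr2 hn A).V q (fun j => S j (q.1 j)) = true) hq
  rwa [card_oneHotQuestions] at this

/-- In round `i` each prover names `i` and the set of rounds where it is asked 1; this wins every
round on all words of `A`. -/
theorem le_value_repetition_wordGame {r n : ℕ} (hr : 2 ≤ r) (hn : 1 ≤ n)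
    (A : Finset (Fin n → Fin r)) :
    (A.card : ℝ) / (r : ℝ) ^ n ≤ ((wordGame hr hn A).repetition n).value := by
  classical
  let S : ((wordGame hr hn A).repetition n).Strategy :=
    fun _ x i => (i, Finset.univ.filter fun m => x m = 1)
  refine le_trans ?_ (((wordGame hr hn A).repetition n).isGreatest_value.2 ⟨S, rfl⟩)
  have hfin := ((oneHotQuestions r hr).pow n).finite.to_subtype
  rw [MultiProverGame.winProb, ← Nat.card_congr (wordEquiv hr n), Nat.card_fun, Nat.card_fin,
    Nat.card_fin, Nat.cast_pow]
  gcongr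
  rw [← Nat.card_eq_finsetCard A]
  refine Nat.card_le_card_of_injective (fun w => ⟨wordEquiv hr n w.1, ?_⟩) ?_
  · simp only [MultiProverGame.repetition, wordGame, decide_eq_true_eq]
    refine fun i => ⟨i, w.1, w.2, rfl, fun j => Prod.ext rfl ?_⟩
    ext m
    simp only [S, Finset.mem_filter, Finset.mem_univ, true_and, wordEquiv_apply,
      oneHot_eq_one_iff, eq_comm (a := j)]
  · intro w w' h
    exact Subtype.ext ((wordEquiv hr n).injective (congrArg Subtype.val h))

/-! ### Choice of parameters -/

theorem mainTheorem8 (ℓ : ℕ) (hℓ : 2 ≤ ℓ) (r : ℕ) (hr : r = 2 ^ (ℓ - 1) + 1) :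
    ∃ C : ℝ, 0 < C ∧ ∀ n : ℕ, 2 ≤ n →
      ∃ G : MultiProverGame (oneHotQuestions r (two_le_of_eq_two_pow_add_one hr)),
        G.value ≤ 1 - 1 / (r : ℝ) ∧
        2 ^ (r * n) ≤ G.answerSize ∧ G.answerSize ≤ 2 ^ (2 * r * n) ∧
        (G.repetition n).value ≥
          Real.exp (-(C * (n : ℝ) *
            ((Real.logb 2 (Real.logb 2 (G.answerSize : ℝ))) ^ (1 / (ℓ : ℝ)) /
              Real.logb 2 (G.answerSize : ℝ)))) := by
  have hr3 : 3 ≤ r := by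
    have : 2 ^ 1 ≤ 2 ^ (ℓ - 1) := Nat.pow_le_pow_right (by norm_num) (by omega)
    omega
  obtain ⟨C, hC⟩ := exists_dense_lineFree hr.ge
  have hr0 : (0 : ℝ) < r := by exact_mod_cast (by omega : 0 < r)
  -- The factor `2 * r` absorbs `L ≤ 2 * r * n`, the 2 absorbs rounding `T` up to `s`, and `C + 1`
  -- keeps the constant positive.
  refine ⟨2 * r * (2 * (C + 1)), by positivity, fun n hn => ?_⟩
  have hn0 : (0 : ℝ) < n := by exact_mod_cast (by omega : 0 < n)
  have hlow : 2 ^ (r * n) ≤ (n * 2 ^ n) ^ r := by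
    rw [mul_comm, pow_mul]
    exact Nat.pow_le_pow_left (Nat.le_mul_of_pos_left _ (by omega)) _
  have hupp : (n * 2 ^ n) ^ r ≤ 2 ^ (2 * r * n) := by
    rw [show 2 * r * n = (n + n) * r by ring, pow_mul, pow_add]
    exact Nat.pow_le_pow_left (Nat.mul_le_mul_right _ Nat.lt_two_pow_self.le) _
  set M := (n * 2 ^ n) ^ r with hM
  set L : ℝ := Real.logb 2 (M : ℝ) with hL
  have hMpos : (0 : ℝ) < M := by
    exact_mod_cast lt_of_lt_of_le (by positivity) hlow
  have hLlow : ((r * n : ℕ) : ℝ) ≤ L := by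
    rw [hL, Real.le_logb_iff_rpow_le one_lt_two hMpos, Real.rpow_natCast]
    exact_mod_cast hlow
  have hLupp : L ≤ 2 * r * n := by
    have : L ≤ ((2 * r * n : ℕ) : ℝ) := by
      rw [hL, Real.logb_le_iff_le_rpow one_lt_two hMpos, Real.rpow_natCast]
      exact_mod_cast hupp
    exact_mod_cast this
  have hrn : (2 : ℝ) ≤ ((r * n : ℕ) : ℝ) := by
    exact_mod_cast (by nlinarith : 2 ≤ r * n)
  have hLpos : 0 < L := by linarith
  set T : ℝ := (Real.logb 2 L) ^ (1 / (ℓ : ℝ)) with hT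
  have hloglog : 1 ≤ Real.logb 2 L := by
    rw [Real.le_logb_iff_rpow_le one_lt_two hLpos, Real.rpow_one]
    linarith
  have hT1 : 1 ≤ T := Real.one_le_rpow hloglog (by positivity)
  have hTpow : T ^ ℓ = Real.logb 2 L := by
    rw [hT, ← Real.rpow_natCast, ← Real.rpow_mul (by linarith), one_div,
      inv_mul_cancel₀ (by exact_mod_cast (by omega : ℓ ≠ 0)), Real.rpow_one]
  -- Rounding up gives `logb 2 L ≤ s ^ ℓ`, hence `r * n ≤ L ≤ 2 ^ s ^ ℓ`, as the density bound
  -- requires.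
  set s : ℕ := ⌈T⌉₊ with hs
  have hsT : T ≤ s := Nat.le_ceil T
  have hs2T : (s : ℝ) ≤ 2 * T := by
    have := Nat.ceil_lt_add_one (by linarith : 0 ≤ T)
    linarith
  have hs1 : 1 ≤ s := by exact_mod_cast hT1.trans hsT
  have hrns : r * n ≤ 2 ^ s ^ (ℓ - 1 + 1) := by
    rw [Nat.sub_add_cancel (by omega)]
    have h1 : ((r * n : ℕ) : ℝ) ≤ (2 : ℝ) ^ ((s ^ ℓ : ℕ) : ℝ) := by
      refine hLlow.trans ?_
      rw [← Real.logb_le_iff_le_rpow one_lt_two hLpos, ← hTpow, Nat.cast_pow]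
      gcongr
    rw [Real.rpow_natCast] at h1
    exact_mod_cast h1
  obtain ⟨A, hA, hAcard⟩ := hC s n hs1 (by omega) hrns
  refine ⟨wordGame (by omega) (by omega) A, value_wordGame_le hr3 (by omega) A hA, ?_⟩
  rw [answerSize_wordGame, ← hM, ← hL, ← hT]
  refine ⟨hlow, hupp, ge_iff_le.2 ?_⟩
  refine le_trans ?_ (le_value_repetition_wordGame (by omega) (by omega) A)
  have hexp : 2 * (C + 1) * T ≤ 2 * r * (2 * (C + 1)) * (n : ℝ) * (T / L) := by
    rw [mul_div_assoc', le_div_iff₀ hLpos]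
    calc 2 * (C + 1) * T * L ≤ 2 * (C + 1) * T * (2 * r * n) := by gcongr
      _ = _ := by ring
  have hexp2 : (2 : ℝ) ^ (C * s) ≤ Real.exp (2 * (C + 1) * T) := by
    calc (2 : ℝ) ^ (C * s) ≤ Real.exp 1 ^ (C * s) := by
          gcongr
          have := Real.add_one_le_exp (1 : ℝ)
          linarith
      _ = Real.exp (C * s) := by rw [← Real.exp_nat_mul]; push_cast; ring_nf
      _ ≤ Real.exp (2 * (C + 1) * T) := by
          refine Real.exp_le_exp.2 ?_
          nlinarith [mul_le_mul_of_nonneg_left hs2T (Nat.cast_nonneg C)]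
  calc _ ≤ Real.exp (-(2 * (C + 1) * T)) := by gcongr
    _ ≤ ((2 : ℝ) ^ (C * s))⁻¹ := by
        rw [Real.exp_neg]
        gcongr
    _ ≤ (A.card : ℝ) / (r : ℝ) ^ n := by
        rw [le_div_iff₀ (by positivity), inv_mul_le_iff₀ (by positivity)]
        exact_mod_cast hAcard
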